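/- **Theorem.** Scheduling with testing: $n$ jobs are to be scheduled on a single machine. Job $j$ has an upper limit $\bar p_j$ and a processing time $p_j$ with $0\le p_j\le \bar p_j$. Initially only $\bar p_j$ is known. Each job $j$ is either executed untested, which takes time $\bar p_j$, or it is tested, which takes time $1$ and reveals $p_j$, and is executed at an arbitrary later time, which takes time $p_j$. The machine carries out one operation (a test or an execution) at a time, without interruption, and may idle. The objective is to minimize the sum $\sum_j C_j$ of the completion times of the jobs; $\mathrm{Opt}(I)$ denotes the optimal value of instance $I$ when all $p_j$ are known. A randomized algorithm $\mathrm{Alg}$ is called $\rho$-competitive if $\mathbb E[\mathrm{Alg}(I)]\le \rho\cdot \mathrm{Opt}(I)$ for every instance $I$. The algorithm $\mathrm{Random}_{T,E}$ with parameters $1\le T\le E$ first executes all jobs with $\bar p_j<T$ untested, in order of increasing $\bar p_j$. Then it tests all jobs with $\bar p_j\ge T$ in uniformly random order; a tested job $j$ is executed immediately after its test if $p_j\le E$, and is deferred otherwise. Finally all deferred jobs are executed in order of increasing $p_j$. Then the following hold. 1. There are real numbers $T,E$ that satisfy $$4(T-1)-\frac1{T-1}=\frac ET,\qquad 4E\bigl(1-(2-T)T^2\bigr)=\bigl(2T(T-1)-1\bigr)^2,$$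 $|T-1.7453|<5\cdot 10^{-5}$, $|E-2.8609|<5\cdot 10^{-5}$ and $T<1.7453$, such that $\mathrm{Random}_{T,E}$ is $T$-competitive (hence $1.7453$-competitive). 2. With the rounded parameters $T=1.7453$ and $E=2.8609$, $\mathrm{Random}_{T,E}$ is $1.7453$-competitive. -/

import Mathlib

open scoped NNReal

/-- An instance of single-machine scheduling with testing: `n` jobs, where job `j` has upper limit
`ub j` and (initially hidden) processing time `p j` with `0 ≤ p j ≤ ub j`. -/
structure TestInstance where
  n : ℕ
  ub : Fin n → ℝ
  p : Fin n → ℝ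
  p_nonneg : ∀ j, 0 ≤ p j
  p_le_ub : ∀ j, p j ≤ ub j

/-- The operations that the machine can carry out: executing a job untested, testing a job,
executing a previously tested job, or staying idle for `d` time units. -/
inductive MachineOp (n : ℕ) where
  | runUntested (j : Fin n)
  | test (j : Fin n)
  | runTested (j : Fin n)
  | idle (d : ℝ≥0)

namespace MachineOp

/-- The job that an operation concerns (none for idling). -/
def job {n : ℕ} : MachineOp n → Option (Fin n)
  | runUntested j => some j
  | test j => some j
  | runTested j => some j
  | idle _ => none

/-- The job that an operation completes (none for testing and idling). -/
def completes {n : ℕ} : MachineOp n → Option (Fin n)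
  | runUntested j => some j
  | test _ => none
  | runTested j => some j
  | idle _ => none

end MachineOp

namespace TestInstance

/-- A schedule lists the operations of the machine in the order in which they are carried out, each
one starting when the preceding one ends. It is feasible if every job is either executed untested
exactly once and never tested, or tested exactly once and executed exactly once at a later time. -/
def Feasible (I : TestInstance) (S : List (MachineOp I.n)) : Prop :=
  ∀ j : Fin I.n,
    S.filter (fun o => decide (o.job = some j)) = [MachineOp.runUntested j] ∨
    S.filter (fun o => decide (o.job = some j)) = [MachineOp.test j, MachineOp.runTested j]

/-- The duration of an operation. -/
def duration (I : TestInstance) : MachineOp I.n → ℝ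
  | .runUntested j => I.ub j
  | .test _ => 1
  | .runTested j => I.p j
  | .idle d => (d : ℝ)

/-- The completion time of job `j` in a schedule that starts at time `0`: the total duration of all
operations up to and including the one that completes `j`. -/
def completionTime (I : TestInstance) (j : Fin I.n) : List (MachineOp I.n) → ℝ
  | [] => 0
  | o :: S => I.duration o + if o.completes = some j then 0 else I.completionTime j S

/-- The cost of a schedule: the sum of the completion times of all jobs. -/
def cost (I : TestInstance) (S : List (MachineOp I.n)) : ℝ :=
  ∑ j : Fin I.n, I.completionTime j S

/-- The optimal (offline) cost: the infimum of the costs of all feasible schedules. -/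
noncomputable def opt (I : TestInstance) : ℝ :=
  sInf (I.cost '' {S | I.Feasible S})

/-- First phase of the algorithm: the jobs with upper limit below `T` are executed untested, in
order of increasing upper limit. -/
noncomputable def untestedPhase (I : TestInstance) (T : ℝ) : List (MachineOp I.n) :=
  (((List.finRange I.n).filter (fun j => decide (I.ub j < T))).insertionSort
    (fun i j => I.ub i ≤ I.ub j)).map MachineOp.runUntested

/-- The jobs with upper limit at least `T`, in their given order. -/
noncomputable def testJobs (I : TestInstance) (T : ℝ) : List (Fin I.n) :=
  (List.finRange I.n).filter (fun j => decide (T ≤ I.ub j))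

/-- Second phase of the algorithm: the given jobs are tested in the given order, and a tested job
with processing time at most `E` is executed immediately after its test. -/
noncomputable def testPhase (I : TestInstance) (E : ℝ) (order : List (Fin I.n)) :
    List (MachineOp I.n) :=
  order.flatMap fun j =>
    if I.p j ≤ E then [MachineOp.test j, MachineOp.runTested j] else [MachineOp.test j]

/-- Third phase of the algorithm: the deferred jobs, i.e. the tested jobs with processing time
greater than `E`, are executed in order of increasing processing time. -/
noncomputable def deferredPhase (I : TestInstance) (E : ℝ) (order : List (Fin I.n)) :
    List (MachineOp I.n) :=
  ((order.filter (fun j => decide (E < I.p j))).insertionSort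
    (fun i j => I.p i ≤ I.p j)).map MachineOp.runTested

/-- The order of the tested jobs that results from permuting them by `σ`. -/
noncomputable def testOrder (I : TestInstance) (T : ℝ)
    (σ : Equiv.Perm (Fin (I.testJobs T).length)) : List (Fin I.n) :=
  List.ofFn fun i => (I.testJobs T).get (σ i)

/-- The schedule of the algorithm Random with parameters `T` and `E` when the tested jobs are
permuted by `σ`. -/
noncomputable def randomSchedule (I : TestInstance) (T E : ℝ)
    (σ : Equiv.Perm (Fin (I.testJobs T).length)) : List (MachineOp I.n) :=
  I.untestedPhase T ++ I.testPhase E (I.testOrder T σ) ++ I.deferredPhase E (I.testOrder T σ)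

/-- The expected cost of the algorithm Random with parameters `T` and `E`, where the order of the
tests is uniformly distributed over all orders of the tested jobs. -/
noncomputable def randomExpectedCost (T E : ℝ) (I : TestInstance) : ℝ :=
  (∑ σ : Equiv.Perm (Fin (I.testJobs T).length), I.cost (I.randomSchedule T E σ)) /
    (Fintype.card (Equiv.Perm (Fin (I.testJobs T).length)) : ℝ)

end TestInstance

/-- An algorithm with (expected) cost `alg I` on instance `I` is `ρ`-competitive. -/
def IsCompetitive (alg : TestInstance → ℝ) (ρ : ℝ) : Prop :=
  ∀ I : TestInstance, alg I ≤ ρ * I.opt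

namespace TestInstance

theorem duration_nonneg (I : TestInstance) (o : MachineOp I.n) : 0 ≤ I.duration o := by
  cases o with
  | runUntested j => exact (I.p_nonneg j).trans (I.p_le_ub j)
  | test j => exact zero_le_one
  | runTested j => exact I.p_nonneg j
  | idle d => exact d.2

theorem completionTime_nonneg (I : TestInstance) (j : Fin I.n) (S : List (MachineOp I.n)) :
    0 ≤ I.completionTime j S := by
  induction S with
  | nil => exact le_rfl
  | cons o S ih =>
    rw [completionTime]
    have := I.duration_nonneg o
    split_ifs <;> linarith

theorem bddBelow_cost (I : TestInstance) : BddBelow (I.cost '' {S | I.Feasible S}) :=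
  ⟨0, by rintro _ ⟨S, _, rfl⟩; exact Finset.sum_nonneg fun j _ => I.completionTime_nonneg j S⟩

theorem filter_map_job {n : ℕ} (f : Fin n → MachineOp n) (hf : ∀ j, (f j).job = some j)
    (l : List (Fin n)) (hl : l.Nodup) (j : Fin n) :
    (l.map f).filter (fun o => decide (o.job = some j)) = if j ∈ l then [f j] else [] := by
  induction l with
  | nil => simp
  | cons a l ih =>
    rw [List.nodup_cons] at hl
    rw [List.map_cons, List.filter_cons, ih hl.2]
    by_cases h : a = j
    · subst h; simp [hf, hl.1]
    · simp [hf, h, Ne.symm h]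

theorem filter_testPhase (I : TestInstance) (E : ℝ) (l : List (Fin I.n)) (hl : l.Nodup)
    (j : Fin I.n) :
    (I.testPhase E l).filter (fun o => decide (o.job = some j)) =
      if j ∈ l then
        if I.p j ≤ E then [MachineOp.test j, MachineOp.runTested j] else [MachineOp.test j]
      else [] := by
  induction l with
  | nil => simp [testPhase]
  | cons a l ih =>
    rw [List.nodup_cons] at hl
    have ih := ih hl.2
    simp only [testPhase] at ih ⊢
    rw [List.flatMap_cons, List.filter_append, ih]
    by_cases h : a = j
    · subst h
      by_cases hp : I.p a ≤ E <;> simp [hp, hl.1, MachineOp.job]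
    · by_cases hp : I.p a ≤ E <;> simp [hp, h, Ne.symm h, MachineOp.job]

theorem testOrder_nodup (I : TestInstance) (T : ℝ)
    (σ : Equiv.Perm (Fin (I.testJobs T).length)) : (I.testOrder T σ).Nodup := by
  rw [testOrder, List.nodup_ofFn]
  exact (List.nodup_iff_injective_get.1 ((List.nodup_finRange _).filter _)).comp σ.injective

theorem mem_testOrder (I : TestInstance) (T : ℝ)
    (σ : Equiv.Perm (Fin (I.testJobs T).length)) (j : Fin I.n) :
    j ∈ I.testOrder T σ ↔ T ≤ I.ub j := by
  have h : j ∈ I.testJobs T ↔ T ≤ I.ub j := by simp [testJobs]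
  rw [← h, testOrder, List.mem_ofFn, List.mem_iff_get]
  exact ⟨fun ⟨i, hi⟩ => ⟨σ i, hi⟩, fun ⟨i, hi⟩ => ⟨σ.symm i, by simpa using hi⟩⟩

/-- The schedules produced by the algorithm are feasible. -/
theorem randomSchedule_feasible (I : TestInstance) (T E : ℝ)
    (σ : Equiv.Perm (Fin (I.testJobs T).length)) : I.Feasible (I.randomSchedule T E σ) := by
  intro j
  have hu : (((List.finRange I.n).filter (fun j => decide (I.ub j < T))).insertionSort
      (fun i j => I.ub i ≤ I.ub j)).Nodup :=
    (List.perm_insertionSort _ _).nodup_iff.2 ((List.nodup_finRange _).filter _)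
  have hd : (((I.testOrder T σ).filter (fun j => decide (E < I.p j))).insertionSort
      (fun i j => I.p i ≤ I.p j)).Nodup :=
    (List.perm_insertionSort _ _).nodup_iff.2 ((I.testOrder_nodup T σ).filter _)
  rw [randomSchedule, List.filter_append, List.filter_append, untestedPhase, deferredPhase,
    filter_map_job _ (fun _ => rfl) _ hu, filter_map_job _ (fun _ => rfl) _ hd,
    I.filter_testPhase E _ (I.testOrder_nodup T σ)]
  simp only [List.mem_insertionSort, List.mem_filter, mem_testOrder, List.mem_finRange,
    decide_eq_true_eq, true_and]
  by_cases h : I.ub j < T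
  · simp [h, not_le.2 h]
  · by_cases hp : I.p j ≤ E
    · simp [h, hp, not_lt.1 h, not_lt.2 hp]
    · simp [h, hp, not_lt.1 h, not_le.1 hp]

/-- The infimum in `opt` is over a nonempty set of reals that is bounded below. -/
theorem feasible_nonempty (I : TestInstance) : (I.cost '' {S | I.Feasible S}).Nonempty :=
  ⟨_, I.randomSchedule 0 0 1, I.randomSchedule_feasible 0 0 1, rfl⟩

end TestInstance

/-! Both costs are written as sums over pairs of jobs. Offline, of two jobs one is processed
entirely before the other completes, and each job `j` needs at least `minTime j`; so twice the
optimum is at least the sum of `min (minTime i) (minTime j)` over all ordered pairs plus the sum of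
all `minTime i` (`le_two_mul_opt`). For the algorithm, averaging a test order with its reverse makes
each tested job precede each other one exactly once, which gives an exact pairwise formula
(`two_mul_randomExpectedCost`).

The excess over `T` times the optimum is then bounded pair by pair by a symmetric bilinear form in
vectors attached to the jobs (`delay_add_delay_le`). An immediately executed job is treated as a
mixture of jobs with processing times `0`, `T` and `E`; a deferred job is treated as having
processing time `E`; untested jobs get the vector `0`. By bilinearity, the sum over all pairs is a
quadratic form in only four totals, and `quadratic_form_nonpos` shows that it is nonpositive. The
two relations between `T` and `E` are what this needs: one without deferred jobs, the other for
deferred jobs together with immediate jobs of length `T`. -/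

/-! ### The quadratic form and the parameters. -/

/-- Here `n` counts the immediate jobs, `B` and `C` total their weights for reaching `T` and `E`,
and `m` counts the deferred jobs. The relations enter as inequalities, so that rounded parameters
are covered too. -/
theorem quadratic_form_nonpos {T E : ℝ} (hT1 : 1.745 ≤ T) (hT2 : T ≤ 1.746) (hE1 : 2.86 ≤ E)
    (hE2 : E ≤ 2.862) (h1 : E / T ≤ 4 * (T - 1) - 1 / (T - 1))
    (h2 : (2 * T * (T - 1) - 1) ^ 2 ≤ 4 * E * (1 - (2 - T) * T ^ 2))
    {n B C m : ℝ} (hB : B ≤ n) (hC : 0 ≤ C) (hm : 0 ≤ m) :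
    n ^ 2 * (1 - T) + n * (T * B + (E - T) * C) - T * ((T - 1) * B ^ 2 + (E - T) * C ^ 2) +
      2 * m * ((3 / 2 - T) * n + T * B + (E - T) * C - T * ((T - 1) * B + (E - T) * C)) +
      m ^ 2 * (2 - (T - 1) * E) ≤ 0 := by
  have hT : 0 < T := by linarith
  have hT' : 0 < T - 1 := by linarith
  have h1' : T / (4 * (T - 1)) + (E - T) / (4 * T) ≤ T - 1 := by
    have : T / (4 * (T - 1)) + (E - T) / (4 * T) = (E / T + 1 / (T - 1)) / 4 := by
      field_simp
      ring
    linarith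
  -- The case `m = 0`: completing the squares in `y` and `z` leaves a multiple of `x ^ 2` whose sign
  -- is exactly `h1'`.
  have key : ∀ x y z : ℝ,
      x ^ 2 * (1 - T) + x * (T * y + (E - T) * z) - T * ((T - 1) * y ^ 2 + (E - T) * z ^ 2) ≤ 0 := by
    intro x y z
    have e : x ^ 2 * (1 - T) + x * (T * y + (E - T) * z)
        - T * ((T - 1) * y ^ 2 + (E - T) * z ^ 2) =
        - (T * (T - 1) * (y - x / (2 * (T - 1))) ^ 2 + T * (E - T) * (z - x / (2 * T)) ^ 2
          + x ^ 2 * (T - 1 - (T / (4 * (T - 1)) + (E - T) / (4 * T)))) := by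
      field_simp
      ring
    rw [e]
    have : 0 ≤ E - T := by linarith
    have : 0 ≤ T - 1 - (T / (4 * (T - 1)) + (E - T) / (4 * T)) := by linarith
    have : 0 ≤ (T * (T - 1) * (y - x / (2 * (T - 1))) ^ 2 + T * (E - T) * (z - x / (2 * T)) ^ 2
          + x ^ 2 * (T - 1 - (T / (4 * (T - 1)) + (E - T) / (4 * T)))) := by positivity
    linarith
  have hk : 0 < T ^ 2 - T - 1 := by nlinarith
  -- On the plane `n = B`, `C = 0` the form is maximal at `n = r * m`.
  obtain ⟨r, hr⟩ : ∃ r, r = (3 / 2 + T - T ^ 2) / (T ^ 2 - T - 1) := ⟨_, rfl⟩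
  have hr' : r * (T ^ 2 - T - 1) = 3 / 2 + T - T ^ 2 := by
    rw [hr, div_mul_cancel₀ _ hk.ne']
  have hr0 : 0 ≤ r := by rw [hr]; apply div_nonneg <;> nlinarith
  have hr1 : r ≤ 0.7 := by rw [hr, div_le_iff₀ hk]; nlinarith
  -- This is `h2` rearranged, using `(T ^ 2 - T - 1) * (T - 1) = 1 - (2 - T) * T ^ 2`.
  have hmm : (3 / 2 + T - T ^ 2) * r ≤ (T - 1) * E - 2 := by
    rw [hr, ← mul_div_assoc, div_le_iff₀ hk]
    nlinarith
  have h0 := key (n - r * m) (B - r * m) C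
  have hA : 3 - 2 * T + r * (2 - T) ≤ 0 := by nlinarith
  have hG : (E - T) * (1 - T + r / 2) ≤ 0 :=
    mul_nonpos_of_nonneg_of_nonpos (by linarith) (by linarith)
  have a1 : 0 ≤ (n - B) * m := mul_nonneg (by linarith) hm
  have a2 : 0 ≤ C * m := mul_nonneg hC hm
  have a3 := mul_nonneg a1 (neg_nonneg.2 hA)
  have a4 := mul_nonneg a2 (neg_nonneg.2 hG)
  have a5 := mul_nonneg (sq_nonneg m) (sub_nonneg.2 hmm)
  have a6 : (r * (T ^ 2 - T - 1) - (3 / 2 + T - T ^ 2)) * (2 * m * B - r * m ^ 2) = 0 := by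
    rw [hr', sub_self, zero_mul]
  linarith

/-- The first equation gives `E` as a function of `T`; substituting it into the second leaves one
equation, solved by the intermediate value theorem. -/
theorem exists_threshold_parameters : ∃ T E : ℝ, 4 * (T - 1) - 1 / (T - 1) = E / T ∧
    4 * E * (1 - (2 - T) * T ^ 2) = (2 * T * (T - 1) - 1) ^ 2 ∧
    1.74526 ≤ T ∧ T ≤ 1.745265 ∧ |E - 2.8609| < 0.00005 := by
  have hc : ContinuousOn (fun T : ℝ => 4 * (T * (4 * (T - 1) - 1 / (T - 1))) *
      (1 - (2 - T) * T ^ 2) - (2 * T * (T - 1) - 1) ^ 2) (Set.Icc 1.74526 1.745265) := by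
    have : ContinuousOn (fun T : ℝ => 1 / (T - 1)) (Set.Icc 1.74526 1.745265) :=
      continuousOn_const.div (by fun_prop) fun T hT => by
        have := hT.1
        norm_num at this ⊢
        intro h
        linarith
    fun_prop
  obtain ⟨T, ⟨hT1, hT2⟩, hT⟩ := intermediate_value_Icc (by norm_num) hc
    (show (0 : ℝ) ∈ _ from ⟨by norm_num, by norm_num⟩)
  refine ⟨T, T * (4 * (T - 1) - 1 / (T - 1)), ?_, by simpa [sub_eq_zero] using hT, hT1, hT2, ?_⟩
  · rw [mul_div_cancel_left₀]
    norm_num at hT1; linarith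
  · have h1 : 1.341804 ≤ 1 / (T - 1) := by
      rw [le_div_iff₀ (by norm_num at *; linarith)]; norm_num at *; linarith
    have h2 : 1 / (T - 1) ≤ 1.341814 := by
      rw [div_le_iff₀ (by norm_num at *; linarith)]; norm_num at *; linarith
    rw [abs_lt]
    constructor <;> norm_num at * <;> nlinarith

namespace TestInstance

/-! ### Lower bound on the optimum. -/

/-- The shortest time in which a job can be completed offline. -/
noncomputable def minTime (I : TestInstance) (j : Fin I.n) : ℝ :=
  min (I.ub j) (1 + I.p j)

/-- The total duration of the operations of job `i` in a schedule, up to and including the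
operation that completes job `j`. -/
def workBefore (I : TestInstance) (i j : Fin I.n) : List (MachineOp I.n) → ℝ
  | [] => 0
  | o :: S => (if o.job = some i then I.duration o else 0) +
      if o.completes = some j then 0 else I.workBefore i j S

/-- The total duration of the operations of job `i` in a schedule. -/
def work (I : TestInstance) (i : Fin I.n) (S : List (MachineOp I.n)) : ℝ :=
  ((S.filter (fun o => decide (o.job = some i))).map I.duration).sum

theorem work_cons (I : TestInstance) (i : Fin I.n) (o : MachineOp I.n)
    (S : List (MachineOp I.n)) :
    I.work i (o :: S) = (if o.job = some i then I.duration o else 0) + I.work i S := by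
  by_cases h : o.job = some i <;> simp [work, h]

theorem workBefore_nonneg (I : TestInstance) (i j : Fin I.n) (S : List (MachineOp I.n)) :
    0 ≤ I.workBefore i j S := by
  induction S with
  | nil => exact le_rfl
  | cons o S ih =>
    rw [workBefore]
    have := I.duration_nonneg o
    split_ifs <;> linarith

theorem workBefore_le_work (I : TestInstance) (i j : Fin I.n) (S : List (MachineOp I.n)) :
    I.workBefore i j S ≤ I.work i S := by
  induction S with
  | nil => simp [workBefore, work]
  | cons o S ih =>
    rw [workBefore, work_cons]
    have := I.workBefore_nonneg i j S
    split_ifs <;> linarith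

/-- Every operation before the completion of `j` belongs to at most one job; idle time causes the
inequality. -/
theorem sum_workBefore_le (I : TestInstance) (j : Fin I.n) (S : List (MachineOp I.n)) :
    ∑ i, I.workBefore i j S ≤ I.completionTime j S := by
  induction S with
  | nil => simp [workBefore, completionTime]
  | cons o S ih =>
    simp only [workBefore, completionTime, Finset.sum_add_distrib]
    apply add_le_add
    · cases h : o.job with
      | none => simpa using I.duration_nonneg o
      | some k => simp
    · split_ifs
      · simp
      · exact ih

theorem job_of_completes {n : ℕ} {o : MachineOp n} {j : Fin n} (h : o.completes = some j) :
    o.job = some j := by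
  cases o <;> simp_all [MachineOp.completes, MachineOp.job]

/-- No operation of job `i` follows the completion of `i`. -/
def CompletesLast {n : ℕ} (i : Fin n) (S : List (MachineOp n)) : Prop :=
  ∀ S₁ o S₂, S = S₁ ++ o :: S₂ → o.completes = some i →
    S₂.filter (fun o => decide (o.job = some i)) = []

theorem CompletesLast.of_cons {n : ℕ} {i : Fin n} {o : MachineOp n} {S : List (MachineOp n)}
    (h : CompletesLast i (o :: S)) : CompletesLast i S := by
  intro S₁ o' S₂ hS ho
  exact h (o :: S₁) o' S₂ (by rw [hS, List.cons_append]) ho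

theorem Feasible.completesLast {I : TestInstance} {S : List (MachineOp I.n)} (h : I.Feasible S)
    (i : Fin I.n) : CompletesLast i S := by
  intro S₁ o S₂ hS ho
  have hj := job_of_completes ho
  have h := h i
  rw [hS, List.filter_append, List.filter_cons_of_pos (by simpa using hj)] at h
  generalize S₁.filter (fun o => decide (o.job = some i)) = A at h
  generalize S₂.filter (fun o => decide (o.job = some i)) = B at h ⊢
  match A with
  | [] =>
    rcases h with h | h
    · exact (List.cons.inj h).2
    · simp only [List.nil_append, List.cons.injEq] at h
      rw [h.1] at ho
      simp [MachineOp.completes] at ho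
  | [a] => simp_all
  | a :: b :: A => simp at h

theorem minTime_le_work {I : TestInstance} {S : List (MachineOp I.n)} (h : I.Feasible S)
    (i : Fin I.n) : I.minTime i ≤ I.work i S := by
  rcases h i with h | h <;> simp [work, h, minTime, duration]

/-- Of two jobs, the one that is completed first is processed entirely before the completion of
the other one. -/
theorem workBefore_eq_work_or {I : TestInstance} {i j : Fin I.n} {S : List (MachineOp I.n)}
    (hi : CompletesLast i S) (hj : CompletesLast j S) :
    I.workBefore i j S = I.work i S ∨ I.workBefore j i S = I.work j S := by
  induction S with
  | nil => simp [workBefore, work]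
  | cons o S ih =>
    rw [workBefore, workBefore, work_cons, work_cons]
    by_cases ho : o.completes = some j
    · have hw : I.work j S = 0 := by simp [work, hj [] o S rfl ho]
      have h1 := I.workBefore_nonneg j i S
      have h2 := I.workBefore_le_work j i S
      right
      split_ifs <;> linarith
    · by_cases ho' : o.completes = some i
      · have hw : I.work i S = 0 := by simp [work, hi [] o S rfl ho']
        have h1 := I.workBefore_nonneg i j S
        have h2 := I.workBefore_le_work i j S
        left
        split_ifs <;> linarith
      · rw [if_neg ho, if_neg ho', add_right_inj, add_right_inj]
        exact ih hi.of_cons hj.of_cons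

/-- Each unordered pair contributes at least the smaller `minTime` to the cost. A diagonal pair is
counted twice on the right, which yields the extra single sum. -/
theorem le_two_mul_cost {I : TestInstance} {S : List (MachineOp I.n)} (h : I.Feasible S) :
    ∑ i, ∑ j, min (I.minTime i) (I.minTime j) + ∑ i, I.minTime i ≤ 2 * I.cost S := by
  have h1 : ∑ j, ∑ i, I.workBefore i j S ≤ I.cost S :=
    Finset.sum_le_sum fun j _ => I.sum_workBefore_le j S
  have h2 : ∑ j, ∑ i, I.workBefore j i S ≤ I.cost S := by rwa [Finset.sum_comm]
  have h3 : ∑ i, I.minTime i = ∑ i, ∑ j, if i = j then I.minTime i else 0 := by simp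
  have h4 : ∑ i, ∑ j, min (I.minTime i) (I.minTime j) + ∑ i, I.minTime i ≤
      ∑ i, ∑ j, I.workBefore i j S + ∑ i, ∑ j, I.workBefore j i S := by
    rw [h3]
    simp only [← Finset.sum_add_distrib]
    refine Finset.sum_le_sum fun i _ => Finset.sum_le_sum fun j _ => ?_
    have hi := minTime_le_work h i
    have hj := minTime_le_work h j
    by_cases hij : i = j
    · subst hij
      have := workBefore_eq_work_or (h.completesLast i) (h.completesLast i)
      rw [or_self] at this
      rw [if_pos rfl, min_self, this]
      linarith
    · have h1 := I.workBefore_nonneg i j S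
      have h2 := I.workBefore_nonneg j i S
      have h3 := min_le_left (I.minTime i) (I.minTime j)
      have h4 := min_le_right (I.minTime i) (I.minTime j)
      rw [if_neg hij]
      rcases workBefore_eq_work_or (h.completesLast i) (h.completesLast j) with h | h <;> linarith
  linarith

theorem le_two_mul_opt (I : TestInstance) :
    ∑ i, ∑ j, min (I.minTime i) (I.minTime j) + ∑ i, I.minTime i ≤ 2 * I.opt := by
  have : (∑ i, ∑ j, min (I.minTime i) (I.minTime j) + ∑ i, I.minTime i) / 2 ≤ I.opt := by
    apply le_csInf I.feasible_nonempty
    rintro _ ⟨S, hS, rfl⟩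
    linarith [le_two_mul_cost hS]
  linarith

/-! Completion times of composed schedules -/

theorem completionTime_append_of_forall (I : TestInstance) (j : Fin I.n)
    {S₁ : List (MachineOp I.n)} (h : ∀ o ∈ S₁, o.completes ≠ some j) (S₂ : List (MachineOp I.n)) :
    I.completionTime j (S₁ ++ S₂) = (S₁.map I.duration).sum + I.completionTime j S₂ := by
  induction S₁ with
  | nil => simp
  | cons o S ih =>
    rw [List.forall_mem_cons] at h
    rw [List.cons_append, completionTime, if_neg h.1, ih h.2, List.map_cons, List.sum_cons,
      add_assoc]

theorem completionTime_append_of_exists (I : TestInstance) (j : Fin I.n)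
    {S₁ : List (MachineOp I.n)} (h : ∃ o ∈ S₁, o.completes = some j) (S₂ : List (MachineOp I.n)) :
    I.completionTime j (S₁ ++ S₂) = I.completionTime j S₁ := by
  induction S₁ with
  | nil => simp at h
  | cons o S ih =>
    rw [List.cons_append, completionTime, completionTime]
    split_ifs with ho
    · rfl
    · rw [ih]
      obtain ⟨o', ho', h'⟩ := h
      rcases List.mem_cons.1 ho' with rfl | hm
      · exact absurd h' ho
      · exact ⟨o', hm, h'⟩

/-- The sum of the completion times when jobs are executed in order of increasing duration. -/
theorem two_mul_sum_completionTime_map (I : TestInstance) (f : Fin I.n → MachineOp I.n)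
    (hf : ∀ j, (f j).completes = some j) {l : List (Fin I.n)} (hl : l.Nodup)
    (hs : l.Pairwise fun i j => I.duration (f i) ≤ I.duration (f j)) :
    2 * (l.map fun j => I.completionTime j (l.map f)).sum =
      (l.map fun i => (l.map fun j => min (I.duration (f i)) (I.duration (f j))).sum).sum +
        (l.map fun j => I.duration (f j)).sum := by
  induction l with
  | nil => simp
  | cons a l ih =>
    rw [List.nodup_cons] at hl
    rw [List.pairwise_cons] at hs
    have ih := ih hl.2 hs.2
    have e1 : (l.map fun j => I.completionTime j ((a :: l).map f)) =
        l.map fun j => I.duration (f a) + I.completionTime j (l.map f) := by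
      refine List.map_congr_left fun j hj => ?_
      have : a ≠ j := fun h => hl.1 (h ▸ hj)
      rw [List.map_cons, completionTime, hf, if_neg (by simpa using this)]
    have e2 : (l.map fun j => min (I.duration (f a)) (I.duration (f j))) =
        l.map fun _ => I.duration (f a) :=
      List.map_congr_left fun j hj => min_eq_left (hs.1 j hj)
    have e3 : (l.map fun i => min (I.duration (f i)) (I.duration (f a))) =
        l.map fun _ => I.duration (f a) :=
      List.map_congr_left fun j hj => min_eq_right (hs.1 j hj)
    have e4 : I.completionTime a ((a :: l).map f) = I.duration (f a) := by
      rw [List.map_cons, completionTime, hf, if_pos rfl, add_zero]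
    rw [List.map_cons, List.sum_cons, e4, e1]
    simp only [List.map_cons, List.sum_cons, List.sum_map_add, e2, e3, min_self]
    linarith

/-- The time that the test phase spends on job `j`. -/
noncomputable def testTime (I : TestInstance) (E : ℝ) (j : Fin I.n) : ℝ :=
  if I.p j ≤ E then 1 + I.p j else 1

theorem sum_duration_testPhase (I : TestInstance) (E : ℝ) (l : List (Fin I.n)) :
    ((I.testPhase E l).map I.duration).sum = (l.map (I.testTime E)).sum := by
  induction l with
  | nil => rfl
  | cons a l ih =>
    simp only [testPhase] at ih ⊢
    rw [List.flatMap_cons, List.map_append, List.sum_append, ih, List.map_cons, List.sum_cons,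
      testTime]
    split_ifs <;> simp [duration]

theorem mem_testPhase_completes (I : TestInstance) (E : ℝ) (l : List (Fin I.n)) (j : Fin I.n) :
    (∃ o ∈ I.testPhase E l, o.completes = some j) ↔ j ∈ l ∧ I.p j ≤ E := by
  constructor
  · rintro ⟨o, ho, hj⟩
    obtain ⟨k, hk, ho⟩ := List.mem_flatMap.1 ho
    split_ifs at ho with hp <;> simp only [List.mem_cons, List.not_mem_nil, or_false] at ho
    · rcases ho with rfl | rfl
      · simp [MachineOp.completes] at hj
      · simp only [MachineOp.completes, Option.some.injEq] at hj
        exact hj ▸ ⟨hk, hp⟩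
    · subst ho
      simp [MachineOp.completes] at hj
  · rintro ⟨hj, hp⟩
    exact ⟨.runTested j, List.mem_flatMap.2 ⟨j, hj, by simp [hp]⟩, rfl⟩

theorem completionTime_testPhase_split (I : TestInstance) (E : ℝ) {s t : List (Fin I.n)}
    {j : Fin I.n} (hs : j ∉ s) (hp : I.p j ≤ E) :
    I.completionTime j (I.testPhase E (s ++ j :: t)) =
      (s.map (I.testTime E)).sum + I.testTime E j := by
  have h : I.testPhase E (s ++ j :: t) =
      I.testPhase E s ++ (.test j :: .runTested j :: I.testPhase E t) := by
    simp [testPhase, hp]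
  rw [h, completionTime_append_of_forall, sum_duration_testPhase]
  · simp [completionTime, MachineOp.completes, duration, testTime, hp]
  · intro o ho hj
    exact hs ((I.mem_testPhase_completes E s j).1 ⟨o, ho, hj⟩).1

/-- In an order of the tests and its reverse together, every job precedes every other job exactly
once. -/
theorem completionTime_testPhase_add_reverse (I : TestInstance) (E : ℝ) {l : List (Fin I.n)}
    (hl : l.Nodup) {j : Fin I.n} (hj : j ∈ l) (hp : I.p j ≤ E) :
    I.completionTime j (I.testPhase E l) + I.completionTime j (I.testPhase E l.reverse) =
      (l.map (I.testTime E)).sum + I.testTime E j := by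
  obtain ⟨s, t, rfl⟩ := List.append_of_mem hj
  have h := List.nodup_append.1 hl
  have hs : j ∉ s := fun hs => h.2.2 j hs j (by simp) rfl
  have ht : j ∉ t := (List.nodup_cons.1 h.2.1).1
  rw [List.reverse_append, List.reverse_cons, List.append_assoc, List.singleton_append,
    completionTime_testPhase_split I E hs hp,
    completionTime_testPhase_split I E (by simpa using ht) hp]
  simp only [List.map_append, List.map_cons, List.sum_append, List.sum_cons, List.map_reverse,
    List.sum_reverse]
  ring

theorem sum_map_eq_sum_ite {n : ℕ} {l : List (Fin n)} (hl : l.Nodup) {P : Fin n → Prop}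
    [DecidablePred P] (h : ∀ j, j ∈ l ↔ P j) (g : Fin n → ℝ) :
    (l.map g).sum = ∑ j, if P j then g j else 0 := by
  rw [← List.sum_toFinset g hl, ← Finset.sum_filter]
  congr 1
  ext j
  simp [h]

theorem sum_ite_two_mul_completionTime_insertionSort (I : TestInstance)
    (f : Fin I.n → MachineOp I.n) (hf : ∀ j, (f j).completes = some j) (d : Fin I.n → ℝ)
    (hd : ∀ j, I.duration (f j) = d j) {l : List (Fin I.n)} (hl : l.Nodup)
    {P : Fin I.n → Prop} [DecidablePred P] (h : ∀ j, j ∈ l ↔ P j) :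
    ∑ j, (if P j then 2 * I.completionTime j
        ((l.insertionSort fun i j => d i ≤ d j).map f) else 0) =
      ∑ j, ((∑ i, if P i ∧ P j then min (d i) (d j) else 0) + if P j then d j else 0) := by
  have : Std.Total fun i j => d i ≤ d j := ⟨fun i j => le_total _ _⟩
  have : IsTrans (Fin I.n) fun i j => d i ≤ d j := ⟨fun _ _ _ => le_trans⟩
  have hn : (l.insertionSort fun i j => d i ≤ d j).Nodup :=
    (List.perm_insertionSort _ _).nodup_iff.2 hl
  have hm : ∀ j, j ∈ (l.insertionSort fun i j => d i ≤ d j) ↔ P j := by simpa using h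
  have key := I.two_mul_sum_completionTime_map f hf hn
    (by simpa only [hd] using List.pairwise_insertionSort (fun i j => d i ≤ d j) l)
  simp only [hd, sum_map_eq_sum_ite hn hm] at key
  rw [Finset.sum_add_distrib, Finset.sum_comm]
  convert key using 2
  · rw [Finset.mul_sum]
    exact Finset.sum_congr rfl fun j _ => by split_ifs <;> ring
  · refine Finset.sum_congr rfl fun i _ => ?_
    by_cases hi : P i <;> simp [hi]

theorem mem_untestedPhase_completes (I : TestInstance) (T : ℝ) (j : Fin I.n) :
    (∃ o ∈ I.untestedPhase T, o.completes = some j) ↔ I.ub j < T := by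
  simp [untestedPhase, MachineOp.completes]

theorem sum_duration_untestedPhase (I : TestInstance) (T : ℝ) :
    ((I.untestedPhase T).map I.duration).sum = ∑ j, if I.ub j < T then I.ub j else 0 := by
  rw [untestedPhase, List.map_map]
  exact sum_map_eq_sum_ite
    ((List.perm_insertionSort _ _).nodup_iff.2 ((List.nodup_finRange _).filter _))
    (by simp) _

/-- The schedule of the algorithm for a given order of the tests. -/
noncomputable def orderedSchedule (I : TestInstance) (T E : ℝ) (l : List (Fin I.n)) :
    List (MachineOp I.n) :=
  I.untestedPhase T ++ I.testPhase E l ++ I.deferredPhase E l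

section

variable (I : TestInstance) {T E : ℝ} {l : List (Fin I.n)} {j : Fin I.n}

theorem completionTime_orderedSchedule_of_lt (hj : I.ub j < T) :
    I.completionTime j (I.orderedSchedule T E l) = I.completionTime j (I.untestedPhase T) := by
  rw [orderedSchedule, List.append_assoc,
    completionTime_append_of_exists _ _ ((I.mem_untestedPhase_completes T j).2 hj)]

theorem completionTime_orderedSchedule_of_le (hj : T ≤ I.ub j) (hl : j ∈ l) (hp : I.p j ≤ E) :
    I.completionTime j (I.orderedSchedule T E l) =
      (∑ j, if I.ub j < T then I.ub j else 0) + I.completionTime j (I.testPhase E l) := by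
  rw [orderedSchedule, List.append_assoc, completionTime_append_of_forall,
    completionTime_append_of_exists _ _ ((I.mem_testPhase_completes E l j).2 ⟨hl, hp⟩),
    sum_duration_untestedPhase]
  exact fun o ho h => hj.not_gt ((I.mem_untestedPhase_completes T j).1 ⟨o, ho, h⟩)

theorem completionTime_orderedSchedule_of_deferred (hj : T ≤ I.ub j) (hp : E < I.p j) :
    I.completionTime j (I.orderedSchedule T E l) =
      (∑ j, if I.ub j < T then I.ub j else 0) + (l.map (I.testTime E)).sum +
        I.completionTime j (I.deferredPhase E l) := by
  rw [orderedSchedule, List.append_assoc, completionTime_append_of_forall,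
    completionTime_append_of_forall, sum_duration_untestedPhase, sum_duration_testPhase, add_assoc]
  · exact fun o ho h => hp.not_ge ((I.mem_testPhase_completes E l j).1 ⟨o, ho, h⟩).2
  · exact fun o ho h => hj.not_gt ((I.mem_untestedPhase_completes T j).1 ⟨o, ho, h⟩)

end

/-- Twice the expected time by which job `i` delays job `j`, except that the contributions of two
untested or of two deferred jobs are distributed evenly among both. -/
noncomputable def delay (I : TestInstance) (T E : ℝ) (i j : Fin I.n) : ℝ :=
  if I.ub j < T then if I.ub i < T then min (I.ub i) (I.ub j) else 0
  else if I.p j ≤ E then if I.ub i < T then 2 * I.ub i else I.testTime E i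
  else if I.ub i < T then 2 * I.ub i
    else 2 * I.testTime E i + if E < I.p i then min (I.p i) (I.p j) else 0

/-- The part of twice the expected completion time of a job that is not covered by `delay`. -/
noncomputable def ownTime (I : TestInstance) (T E : ℝ) (j : Fin I.n) : ℝ :=
  if I.ub j < T then I.ub j else if I.p j ≤ E then I.testTime E j else I.p j

theorem cost_orderedSchedule_add_reverse (I : TestInstance) {T E : ℝ} {l : List (Fin I.n)}
    (hl : l.Nodup) (hm : ∀ j, j ∈ l ↔ T ≤ I.ub j) :
    I.cost (I.orderedSchedule T E l) + I.cost (I.orderedSchedule T E l.reverse) =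
      ∑ j, (∑ i, I.delay T E i j + I.ownTime T E j) := by
  obtain ⟨X, hX⟩ : ∃ X, X = ∑ j, if I.ub j < T then I.ub j else 0 := ⟨_, rfl⟩
  obtain ⟨W, hW⟩ : ∃ W, W = ∑ j, if T ≤ I.ub j then I.testTime E j else 0 := ⟨_, rfl⟩
  have hWl : (l.map (I.testTime E)).sum = W := by rw [hW, sum_map_eq_sum_ite hl hm]
  have hu := I.sum_ite_two_mul_completionTime_insertionSort .runUntested (fun _ => rfl) I.ub
    (fun _ => rfl) ((List.nodup_finRange I.n).filter (fun j => decide (I.ub j < T)))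
    (P := fun j => I.ub j < T) (by simp)
  have hd := fun {l : List (Fin I.n)} (hl : l.Nodup) (hm : ∀ j, j ∈ l ↔ T ≤ I.ub j) =>
    I.sum_ite_two_mul_completionTime_insertionSort .runTested (fun _ => rfl) I.p
      (fun _ => rfl) (hl.filter (fun j => decide (E < I.p j)))
      (P := fun j => T ≤ I.ub j ∧ E < I.p j) (by simp [hm])
  have hd1 := hd hl hm
  have hd2 := hd (List.nodup_reverse.2 hl) (by simpa using hm)
  rw [← untestedPhase] at hu
  rw [← deferredPhase] at hd1 hd2
  -- Ties may be sorted differently for `l` and its reverse, so the two deferred phases are kept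
  -- apart; only their total costs are known to agree.
  have hC : ∀ j, I.completionTime j (I.orderedSchedule T E l) +
      I.completionTime j (I.orderedSchedule T E l.reverse) =
      (if I.ub j < T then 2 * I.completionTime j (I.untestedPhase T) else 0) +
      ((if T ≤ I.ub j ∧ E < I.p j then 2 * I.completionTime j (I.deferredPhase E l) else 0) +
      (if T ≤ I.ub j ∧ E < I.p j then
        2 * I.completionTime j (I.deferredPhase E l.reverse) else 0)) / 2 +
      if I.ub j < T then 0 else if I.p j ≤ E then 2 * X + W + I.testTime E j
        else 2 * X + 2 * W := by
    intro j
    by_cases hj : I.ub j < T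
    · simp only [completionTime_orderedSchedule_of_lt I hj, if_pos hj, not_le.2 hj, false_and,
        if_false]
      ring
    · by_cases hp : I.p j ≤ E
      · have hmj := (hm j).2 (not_lt.1 hj)
        have := I.completionTime_testPhase_add_reverse E hl hmj hp
        rw [completionTime_orderedSchedule_of_le I (not_lt.1 hj) hmj hp,
          completionTime_orderedSchedule_of_le I (not_lt.1 hj) (List.mem_reverse.2 hmj) hp, ← hX]
        simp only [hj, hp, if_true, if_false, not_lt.2 hp, and_false]
        linarith
      · rw [completionTime_orderedSchedule_of_deferred I (not_lt.1 hj) (not_le.1 hp),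
          completionTime_orderedSchedule_of_deferred I (not_lt.1 hj) (not_le.1 hp), ← hX,
          List.map_reverse, List.sum_reverse, hWl]
        simp only [hj, hp, if_true, if_false, not_lt.1 hj, not_le.1 hp, and_self]
        ring
  rw [cost, cost, ← Finset.sum_add_distrib, Finset.sum_congr rfl fun j _ => hC j,
    Finset.sum_add_distrib, Finset.sum_add_distrib, ← Finset.sum_div, Finset.sum_add_distrib,
    hu, hd1, hd2, add_self_div_two, ← Finset.sum_add_distrib, ← Finset.sum_add_distrib]
  refine Finset.sum_congr rfl fun j _ => ?_
  by_cases hj : I.ub j < T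
  · simp [hj, delay, ownTime, not_le.2 hj]
  · by_cases hp : I.p j ≤ E
    · simp only [hj, hp, delay, ownTime, if_true, if_false, not_lt.2 hp, and_false,
        Finset.sum_const_zero, zero_add, hX, hW, Finset.mul_sum, ← Finset.sum_add_distrib,
        add_left_inj]
      refine Finset.sum_congr rfl fun i _ => ?_
      by_cases hi : I.ub i < T
      · simp [hi, not_le.2 hi]
      · simp [hi, not_lt.1 hi]
    · simp only [hj, hp, delay, ownTime, if_true, if_false, not_lt.1 hj, not_le.1 hp, and_false,
        Finset.sum_const_zero, zero_add, hX, hW, Finset.mul_sum, and_true]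
      rw [add_right_comm, add_left_inj]
      simp only [← Finset.sum_add_distrib]
      refine Finset.sum_congr rfl fun i _ => ?_
      by_cases hi : I.ub i < T
      · simp [hi, not_le.2 hi]
      · simp [hi, not_lt.1 hi, add_comm]

theorem testOrder_mul_revPerm (I : TestInstance) (T : ℝ)
    (σ : Equiv.Perm (Fin (I.testJobs T).length)) :
    I.testOrder T (σ * Fin.revPerm) = (I.testOrder T σ).reverse := by
  apply List.ext_getElem
  · simp [testOrder]
  · intro k h1 h2
    simp only [testOrder, List.getElem_ofFn, List.getElem_reverse, Equiv.Perm.coe_mul,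
      Function.comp_apply, Fin.revPerm_apply, List.length_ofFn]
    congr 2
    ext
    simp [Fin.val_rev]
    omega

theorem two_mul_randomExpectedCost (I : TestInstance) (T E : ℝ) :
    2 * randomExpectedCost T E I = ∑ j, (∑ i, I.delay T E i j + I.ownTime T E j) := by
  -- Reversal is a bijection of the orders, so the mean is unchanged by it.
  have h1 : ∑ σ, I.cost (I.randomSchedule T E (σ * Fin.revPerm)) =
      ∑ σ, I.cost (I.randomSchedule T E σ) :=
    Equiv.sum_comp (Equiv.mulRight (Fin.revPerm : Equiv.Perm (Fin (I.testJobs T).length)))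
      fun σ => I.cost (I.randomSchedule T E σ)
  have h2 : ∀ σ, I.cost (I.randomSchedule T E σ) +
      I.cost (I.randomSchedule T E (σ * Fin.revPerm)) =
      ∑ j, (∑ i, I.delay T E i j + I.ownTime T E j) := fun σ => by
    have := I.cost_orderedSchedule_add_reverse (E := E) (I.testOrder_nodup T σ)
      (I.mem_testOrder T σ)
    rwa [← testOrder_mul_revPerm] at this
  have h3 := Finset.sum_congr (s₁ := Finset.univ) rfl fun σ _ => h2 σ
  rw [Finset.sum_add_distrib, h1, Finset.sum_const, Finset.card_univ, nsmul_eq_mul] at h3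
  rw [randomExpectedCost, ← mul_div_assoc, div_eq_iff (Nat.cast_ne_zero.2 Fintype.card_ne_zero),
    two_mul, h3, mul_comm]

/-! ### Comparison of pairs of jobs. -/

/-- The symmetric bilinear form that bounds the excess of the algorithm over `T` times the optimum,
for job types with coordinates `(n, B, C, m)`. -/
noncomputable def pairForm (T E : ℝ) (v w : Fin 4 → ℝ) : ℝ :=
  v 0 * w 0 * (1 - T) + (v 0 * (T * w 1 + (E - T) * w 2) + w 0 * (T * v 1 + (E - T) * v 2)) / 2 -
    T * ((T - 1) * (v 1 * w 1) + (E - T) * (v 2 * w 2)) +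
    v 3 * ((3 / 2 - T) * w 0 + T * w 1 + (E - T) * w 2 - T * ((T - 1) * w 1 + (E - T) * w 2)) +
    w 3 * ((3 / 2 - T) * v 0 + T * v 1 + (E - T) * v 2 - T * ((T - 1) * v 1 + (E - T) * v 2)) +
    v 3 * w 3 * (2 - (T - 1) * E)

theorem sum_sum_pairForm {n : ℕ} (T E : ℝ) (v : Fin n → Fin 4 → ℝ) :
    ∑ i, ∑ j, pairForm T E (v i) (v j) = pairForm T E (∑ i, v i) (∑ i, v i) := by
  have h1 : ∀ x y w : Fin 4 → ℝ,
      pairForm T E (x + y) w = pairForm T E x w + pairForm T E y w := by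
    intro x y w
    simp only [pairForm, Pi.add_apply]
    ring
  have h2 : ∀ w, pairForm T E 0 w = 0 := by
    intro w
    simp [pairForm]
  have h3 : ∀ x y, pairForm T E x y = pairForm T E y x := by
    intro x y
    simp only [pairForm]
    ring
  let φ : (Fin 4 → ℝ) → (Fin 4 → ℝ) →+ ℝ := fun w =>
    { toFun := fun x => pairForm T E x w, map_zero' := h2 w, map_add' := fun x y => h1 x y w }
  have h4 : ∀ w, pairForm T E (∑ i, v i) w = ∑ i, pairForm T E (v i) w := fun w =>
    map_sum (φ w) v Finset.univ
  rw [h4]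
  refine Finset.sum_congr rfl fun i _ => ?_
  rw [h3, h4]
  exact Finset.sum_congr rfl fun j _ => h3 _ _

/-- The coordinates of a job: for a job that is executed immediately after its test, they record a
decomposition of its processing time as a mixture of `0`, `T` and `E`. -/
noncomputable def jobVector (I : TestInstance) (T E : ℝ) (j : Fin I.n) : Fin 4 → ℝ :=
  if I.ub j < T then 0
  else if I.p j ≤ E then ![1, min (I.p j) (T - 1) / (T - 1), max (I.p j - T) 0 / (E - T), 0]
  else ![0, 0, 0, 1]

section

variable (I : TestInstance) {T E : ℝ}

theorem ub_le_mul_minTime {j : Fin I.n} (hT : 1 ≤ T) (hj : I.ub j ≤ T) :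
    I.ub j ≤ T * I.minTime j := by
  have h0 := I.p_nonneg j
  have h1 := I.p_le_ub j
  rw [minTime, mul_min_of_nonneg _ _ (by linarith)]
  apply le_min <;> nlinarith

theorem one_le_minTime {j : Fin I.n} (hT : 1 ≤ T) (hj : T ≤ I.ub j) : 1 ≤ I.minTime j :=
  le_min (by linarith) (by linarith [I.p_nonneg j])

theorem p_le_minTime (j : Fin I.n) : I.p j ≤ I.minTime j :=
  le_min (I.p_le_ub j) (by linarith)

/-- The expression `1 + (T - 1) * b + (E - T) * c` is the least `minTime` possible for the given `p
j` when the upper limit is at least `T`: it equals `1 + p j`, `T` or `p j` on the ranges below `T -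
1`, up to `T`, and above. The mixture itself only rounds `p j` up. -/
theorem immediate_bounds {j : Fin I.n} (hT : 1 < T) (hE : T < E) (hj : T ≤ I.ub j)
    (hp : I.p j ≤ E) :
    ∃ b c : ℝ, I.jobVector T E j = ![1, b, c, 0] ∧ 0 ≤ b ∧ b ≤ 1 ∧ 0 ≤ c ∧ c ≤ 1 ∧
      I.p j ≤ T * b + (E - T) * c ∧ 1 + (T - 1) * b + (E - T) * c ≤ I.minTime j := by
  have h0 := I.p_nonneg j
  have h1 := I.p_le_ub j
  have hT' : 0 < T - 1 := by linarith
  have hE' : 0 < E - T := by linarith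
  refine ⟨_, _, by rw [jobVector, if_neg (not_lt.2 hj), if_pos hp], ?_, ?_, ?_, ?_, ?_, ?_⟩
  · exact div_nonneg (le_min h0 hT'.le) hT'.le
  · exact div_le_one_of_le₀ (min_le_right _ _) hT'.le
  · exact div_nonneg (le_max_right _ _) hE'.le
  · exact div_le_one_of_le₀ (max_le (by linarith) hE'.le) hE'.le
  · rw [mul_div_cancel₀ _ hE'.ne']
    have h2 := le_max_left (I.p j - T) 0
    have h3 := le_max_right (I.p j - T) 0
    rcases le_total (I.p j) (T - 1) with h | h
    · rw [min_eq_left h, ← mul_div_assoc]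
      have : I.p j ≤ T * I.p j / (T - 1) := by
        rw [le_div_iff₀ hT']
        nlinarith
      linarith
    · rw [min_eq_right h, div_self hT'.ne']
      linarith
  · rw [mul_div_cancel₀ _ hE'.ne', mul_div_cancel₀ _ hT'.ne', minTime]
    rcases le_total (I.p j) T with h | h
    · rw [max_eq_right (by linarith)]
      have h2 := min_le_left (I.p j) (T - 1)
      have h3 := min_le_right (I.p j) (T - 1)
      apply le_min <;> linarith
    · rw [max_eq_left (by linarith), min_eq_right (by linarith)]
      apply le_min <;> linarith

theorem deferred_jobVector {j : Fin I.n} (hj : T ≤ I.ub j) (hp : E < I.p j) :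
    I.jobVector T E j = ![0, 0, 0, 1] := by
  rw [jobVector, if_neg (not_lt.2 hj), if_neg (not_le.2 hp)]

/-- This explains the coefficients of `pairForm`. Two immediate jobs delay each other by `2 + p i +
p j`; an immediate `i` and a deferred `j` by `3 + 2 * p i`; two deferred jobs by `4 + 2 * min (p i)
(p j)`, where `p > E` gives the entry `2 - (T - 1) * E`. An untested job costs at most `T` times the
smaller `minTime` in every pair. -/
theorem delay_add_delay_le (hT' : 1 < T) (hE : T < E) (i j : Fin I.n) :
    I.delay T E i j + I.delay T E j i ≤ 2 * (T * min (I.minTime i) (I.minTime j)) +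
      2 * pairForm T E (I.jobVector T E i) (I.jobVector T E j) := by
  have hT : 1 ≤ T := by linarith
  have hE' : 0 < E - T := by linarith
  have hT0 : 0 < T - 1 := by linarith
  rw [mul_min_of_nonneg _ _ (by linarith)]
  by_cases hi : I.ub i < T
  · have vi : I.jobVector T E i = 0 := if_pos hi
    have e0 : pairForm T E (I.jobVector T E i) (I.jobVector T E j) = 0 := by
      simp [pairForm, vi]
    have qi := I.ub_le_mul_minTime hT hi.le
    rw [e0]
    by_cases hj : I.ub j < T
    · have qj := I.ub_le_mul_minTime hT hj.le
      simp only [delay, hi, hj, if_true]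
      rw [min_comm (I.ub j)]
      linarith [min_le_min qi qj]
    · have qj := I.one_le_minTime hT (not_lt.1 hj)
      have : I.ub i ≤ min (T * I.minTime i) (T * I.minTime j) := le_min qi (by nlinarith)
      simp only [delay, hi, hj, if_true, if_false]
      split_ifs <;> linarith
  by_cases hj : I.ub j < T
  · have vj : I.jobVector T E j = 0 := if_pos hj
    have e0 : pairForm T E (I.jobVector T E i) (I.jobVector T E j) = 0 := by
      simp [pairForm, vj]
    have qj := I.ub_le_mul_minTime hT hj.le
    have qi := I.one_le_minTime hT (not_lt.1 hi)
    have : I.ub j ≤ min (T * I.minTime i) (T * I.minTime j) := le_min (by nlinarith) qj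
    rw [e0]
    simp only [delay, hi, hj, if_true, if_false]
    split_ifs <;> linarith
  rw [← mul_min_of_nonneg _ _ (by linarith)]
  by_cases hpi : I.p i ≤ E
  · obtain ⟨b, c, vi, hb0, hb1, hc0, hc1, hp, hq⟩ :=
      I.immediate_bounds hT' hE (not_lt.1 hi) hpi
    by_cases hpj : I.p j ≤ E
    · obtain ⟨b', c', vj, hb0', hb1', hc0', hc1', hp', hq'⟩ :=
        I.immediate_bounds hT' hE (not_lt.1 hj) hpj
      -- Products bound the minima of the weights from below, which makes the estimate bilinear.
      have hb : b * b' ≤ b := mul_le_of_le_one_right hb0 hb1'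
      have hb' : b * b' ≤ b' := mul_le_of_le_one_left hb0' hb1
      have hc : c * c' ≤ c := mul_le_of_le_one_right hc0 hc1'
      have hc' : c * c' ≤ c' := mul_le_of_le_one_left hc0' hc1
      have hm : 1 + (T - 1) * (b * b') + (E - T) * (c * c') ≤
          min (I.minTime i) (I.minTime j) :=
        le_min (by nlinarith) (by nlinarith)
      have hm := mul_le_mul_of_nonneg_left hm (show 0 ≤ T by linarith)
      simp [delay, hi, hj, hpi, hpj, vi, vj, pairForm, testTime]
      linarith
    · have vj := I.deferred_jobVector (not_lt.1 hj) (not_le.1 hpj)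
      have hm : 1 + (T - 1) * b + (E - T) * c ≤ min (I.minTime i) (I.minTime j) := by
        refine le_min hq ?_
        have := I.p_le_minTime j
        nlinarith
      have hm := mul_le_mul_of_nonneg_left hm (show 0 ≤ T by linarith)
      simp [delay, hi, hj, hpi, hpj, vi, vj, pairForm, testTime, not_lt.2 hpi]
      linarith
  · have vi := I.deferred_jobVector (not_lt.1 hi) (not_le.1 hpi)
    by_cases hpj : I.p j ≤ E
    · obtain ⟨b, c, vj, hb0, hb1, hc0, hc1, hp, hq⟩ :=
        I.immediate_bounds hT' hE (not_lt.1 hj) hpj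
      have hm : 1 + (T - 1) * b + (E - T) * c ≤ min (I.minTime i) (I.minTime j) := by
        refine le_min ?_ hq
        have := I.p_le_minTime i
        nlinarith
      have hm := mul_le_mul_of_nonneg_left hm (show 0 ≤ T by linarith)
      simp [delay, hi, hj, hpi, hpj, vi, vj, pairForm, testTime, not_lt.2 hpj]
      linarith
    · have vj := I.deferred_jobVector (not_lt.1 hj) (not_le.1 hpj)
      have hm : min (I.p i) (I.p j) ≤ min (I.minTime i) (I.minTime j) :=
        min_le_min (I.p_le_minTime i) (I.p_le_minTime j)
      have hm := mul_le_mul_of_nonneg_left hm (show 0 ≤ T by linarith)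
      have hE : E ≤ min (I.p i) (I.p j) := le_min (not_le.1 hpi).le (not_le.1 hpj).le
      have hE := mul_le_mul_of_nonneg_left hE (show 0 ≤ T - 1 by linarith)
      simp only [delay, hi, hj, hpi, hpj, vi, vj, testTime, not_le.1 hpi, not_le.1 hpj, if_true,
        if_false]
      simp [pairForm]
      rw [min_comm (I.p j)]
      linarith

theorem ownTime_le (hT1 : 1.745 ≤ T) (hE1 : 2.86 ≤ E) (j : Fin I.n) :
    I.ownTime T E j ≤ T * I.minTime j := by
  have h0 := I.p_nonneg j
  have h1 := I.p_le_ub j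
  rw [ownTime]
  split_ifs with hj hp
  · exact I.ub_le_mul_minTime (by linarith) hj.le
  · rw [testTime, if_pos hp, minTime, mul_min_of_nonneg _ _ (by linarith)]
    -- For `1 + p j ≤ T * ub j`, use `ub j ≥ p j`, `ub j ≥ T` and `T * (T - 1) ≥ 1`.
    apply le_min <;> nlinarith
  · have := I.p_le_minTime j
    nlinarith

theorem jobVector_bounds (hT : 1 < T) (hE : T < E) (j : Fin I.n) :
    I.jobVector T E j 1 ≤ I.jobVector T E j 0 ∧ 0 ≤ I.jobVector T E j 2 ∧
      0 ≤ I.jobVector T E j 3 := by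
  by_cases hj : I.ub j < T
  · simp [jobVector, hj]
  · by_cases hp : I.p j ≤ E
    · obtain ⟨b, c, v, -, hb, hc, -⟩ := I.immediate_bounds hT hE (not_lt.1 hj) hp
      simp [v, hb, hc]
    · simp [I.deferred_jobVector (not_lt.1 hj) (not_le.1 hp)]

end

/-! ### Competitiveness. -/

theorem isCompetitive_randomExpectedCost {T E : ℝ} (hT1 : 1.745 ≤ T) (hT2 : T ≤ 1.746)
    (hE1 : 2.86 ≤ E) (hE2 : E ≤ 2.862) (h1 : E / T ≤ 4 * (T - 1) - 1 / (T - 1))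
    (h2 : (2 * T * (T - 1) - 1) ^ 2 ≤ 4 * E * (1 - (2 - T) * T ^ 2)) :
    IsCompetitive (randomExpectedCost T E) T := by
  intro I
  have hv := I.jobVector_bounds (T := T) (E := E) (by linarith) (by linarith)
  have hQ : ∑ i, ∑ j, pairForm T E (I.jobVector T E i) (I.jobVector T E j) ≤ 0 := by
    rw [sum_sum_pairForm]
    have hB : (∑ i, I.jobVector T E i) 1 ≤ (∑ i, I.jobVector T E i) 0 := by
      simpa only [Finset.sum_apply] using Finset.sum_le_sum fun i _ => (hv i).1
    have hC : 0 ≤ (∑ i, I.jobVector T E i) 2 := by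
      simpa only [Finset.sum_apply] using Finset.sum_nonneg fun i _ => (hv i).2.1
    have hm : 0 ≤ (∑ i, I.jobVector T E i) 3 := by
      simpa only [Finset.sum_apply] using Finset.sum_nonneg fun i _ => (hv i).2.2
    have := quadratic_form_nonpos hT1 hT2 hE1 hE2 h1 h2 hB hC hm
    rw [pairForm]
    linarith
  have hD : ∑ i, ∑ j, (I.delay T E i j + I.delay T E j i) ≤
      ∑ i, ∑ j, (2 * (T * min (I.minTime i) (I.minTime j)) +
        2 * pairForm T E (I.jobVector T E i) (I.jobVector T E j)) :=
    Finset.sum_le_sum fun i _ => Finset.sum_le_sum fun j _ =>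
      I.delay_add_delay_le (by linarith) (by linarith) i j
  have hO : ∑ j, I.ownTime T E j ≤ ∑ j, T * I.minTime j :=
    Finset.sum_le_sum fun j _ => I.ownTime_le hT1 hE1 j
  have hopt := mul_le_mul_of_nonneg_left I.le_two_mul_opt (show 0 ≤ T by linarith)
  have hA := I.two_mul_randomExpectedCost T E
  simp only [Finset.sum_add_distrib, ← Finset.mul_sum] at hD hO hA
  -- Both double sums in `hD` thus become the one in `hA`.
  rw [Finset.sum_comm (f := fun i j => I.delay T E i j)] at hD
  linarith

end TestInstance

theorem mainTheorem3 :
    (∃ T E : ℝ,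
      4 * (T - 1) - 1 / (T - 1) = E / T ∧
      4 * E * (1 - (2 - T) * T ^ 2) = (2 * T * (T - 1) - 1) ^ 2 ∧
      |T - 1.7453| < 0.00005 ∧ |E - 2.8609| < 0.00005 ∧ T < 1.7453 ∧
      IsCompetitive (TestInstance.randomExpectedCost T E) T) ∧
    IsCompetitive (TestInstance.randomExpectedCost 1.7453 2.8609) 1.7453 := by
  constructor
  · obtain ⟨T, E, h1, h2, hT1, hT2, hE⟩ := exists_threshold_parameters
    have hE' := abs_lt.1 hE
    refine ⟨T, E, h1, h2, abs_lt.2 ⟨by linarith, by linarith⟩, hE, by linarith, ?_⟩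
    exact TestInstance.isCompetitive_randomExpectedCost (by linarith) (by linarith)
      (by linarith [hE'.1]) (by linarith [hE'.2]) h1.ge h2.ge
  · apply TestInstance.isCompetitive_randomExpectedCost <;> norm_num
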